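/- Permutons and height functions. A permuton is a probability measure $\mu$ on $[0,1]^2$ with uniform marginals, i.e. $\mu([0,1]\times[a,b])=\mu([a,b]\times[0,1])=b-a$ for all $0\le a\le b\le 1$. Its height function is $\mathbf H_\mu(x,y)=\mu([x,1]\times[0,y])$ for $x,y\in[0,1]$. For $n\ge 1$ and a permutation $u\in\mathfrak S_n$, let $\pi_u$ be the permuton with constant density $n$ on each of the squares $\left[\tfrac{i-1}{n},\tfrac{i}{n}\right]\times\left[\tfrac{u(i)-1}{n},\tfrac{u(i)}{n}\right]$, $1\le i\le n$, and density $0$ elsewhere. The identity permuton is the uniform probability measure on the diagonal $\{(x,x):x\in[0,1]\}$, i.e. the image of Lebesgue measure on $[0,1]$ under $x\mapsto(x,x)$. Demazure product of permutations. For $1\le i\le n-1$, let $s_i=(i\ \,i+1)\in\mathfrak S_n$, and let $\tau_i:\mathfrak S_n\to\mathfrak S_n$ be the operator with $\tau_i(u)=us_i$ if $u(i)<u(i+1)$ and $\tau_i(u)=u$ otherwise. The Demazure product on $\mathfrak S_n$ is the unique associative product $\star$ on $\mathfrak S_n$ that has the identity permutation as identity element and satisfies $u\star s_i=\tau_i(u)$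 for all $u\in\mathfrak S_n$ and $1\le i\le n-1$. Proposition. 1. For all permutons $\mu,\nu$ there is a unique permuton $\mu\star\nu$ such that $$\mathbf H_{\mu\star\nu}(x,y)=\min_{0\le\gamma\le 1}\bigl(\mathbf H_\mu(\gamma,y)+\mathbf H_\nu(x,\gamma)\bigr)\qquad\text{for all }x,y\in[0,1]$$ (in particular, the minimum is attained). 2. Let $\mu,\nu$ be permutons, and let $(u_n)_{n\ge1}$ and $(v_n)_{n\ge1}$ be sequences with $u_n,v_n\in\mathfrak S_n$ such that $\pi_{u_n}\to\mu$ weakly and $\pi_{v_n}\to\nu$ weakly. Then $\pi_{u_n\star v_n}\to\mu\star\nu$ weakly. 3. The set of permutons is a monoid under $\star$, with the identity permuton as its identity element. -/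

import Mathlib

open Set Filter Topology MeasureTheory
open scoped unitInterval ENNReal

namespace DemazurePermuton

/-! ### The Demazure product of permutations -/

/-- The simple transposition exchanging the adjacent elements `i` and `i + 1` of `Fin n`. -/
def simple {n : ℕ} (i : ℕ) (hi : i + 1 < n) : Equiv.Perm (Fin n) :=
  Equiv.swap ⟨i, Nat.lt_of_succ_lt hi⟩ ⟨i + 1, hi⟩

/-- The operator that puts the entries of `u` in positions `i` and `i + 1` in decreasing order. -/
def bubble {n : ℕ} (i : ℕ) (hi : i + 1 < n) (u : Equiv.Perm (Fin n)) : Equiv.Perm (Fin n) :=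
  if u ⟨i, Nat.lt_of_succ_lt hi⟩ < u ⟨i + 1, hi⟩ then u * simple i hi else u

/-- `op` is a Demazure product on the symmetric group: an associative product, with the identity
permutation as identity element, such that right multiplication by a simple transposition is the
corresponding operator `bubble`. -/
structure IsDemazureMul {n : ℕ}
    (op : Equiv.Perm (Fin n) → Equiv.Perm (Fin n) → Equiv.Perm (Fin n)) : Prop where
  assoc : ∀ u v w, op (op u v) w = op u (op v w)
  one_left : ∀ u, op 1 u = u
  one_right : ∀ u, op u 1 = u
  simple_right : ∀ (u : Equiv.Perm (Fin n)) (i : ℕ) (hi : i + 1 < n),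
    op u (simple i hi) = bubble i hi u

lemma simple_mul_self {n : ℕ} (i : ℕ) (hi : i + 1 < n) :
    simple i hi * simple i hi = 1 := Equiv.swap_mul_self _ _

lemma simple_inv {n : ℕ} (i : ℕ) (hi : i + 1 < n) : (simple i hi)⁻¹ = simple i hi :=
  Equiv.swap_inv _ _

/-- Every property of the identity that the operators `bubble` preserve holds everywhere. -/
lemma bubble_induction {n : ℕ} {P : Equiv.Perm (Fin n) → Prop} (h1 : P 1)
    (h : ∀ i (hi : i + 1 < n) u, P u → P (bubble i hi u)) (u : Equiv.Perm (Fin n)) : P u := by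
  classical
  by_contra hu
  obtain ⟨w, hw, hmax⟩ := (Finset.univ.filter fun w : Equiv.Perm (Fin n) => ¬ P w).exists_max_image
    (fun w => ∑ k : Fin n, (k : ℤ) * (w k : ℤ)) ⟨u, by simpa using hu⟩
  simp only [Finset.mem_filter, Finset.mem_univ, true_and] at hw hmax
  by_cases hd : ∃ (i : ℕ) (hi : i + 1 < n), w ⟨i + 1, hi⟩ < w ⟨i, Nat.lt_of_succ_lt hi⟩
  · obtain ⟨i, hi, hlt⟩ := hd
    have hb : bubble i hi (w * simple i hi) = w := by
      unfold bubble
      rw [if_pos (by simpa [simple] using hlt), mul_assoc, simple_mul_self, mul_one]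
    have hP : ¬ P (w * simple i hi) := fun hP => hw (hb ▸ h i hi _ hP)
    have hle := hmax _ hP
    have hne : (⟨i, Nat.lt_of_succ_lt hi⟩ : Fin n) ≠ ⟨i + 1, hi⟩ := by simp
    have key : ∑ k : Fin n, ((k : ℤ) * ((w * simple i hi) k : ℤ) - (k : ℤ) * (w k : ℤ))
        = (w ⟨i, Nat.lt_of_succ_lt hi⟩ : ℤ) - (w ⟨i + 1, hi⟩ : ℤ) := by
      rw [← Finset.sum_subset
        (Finset.subset_univ {(⟨i, Nat.lt_of_succ_lt hi⟩ : Fin n), ⟨i + 1, hi⟩})]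
      · rw [Finset.sum_pair hne]
        simp [simple]
        ring
      · intro k _ hk
        simp only [Finset.mem_insert, Finset.mem_singleton, not_or] at hk
        simp [simple, Equiv.swap_apply_of_ne_of_ne hk.1 hk.2]
    rw [Finset.sum_sub_distrib] at key
    have : ((w ⟨i + 1, hi⟩ : ℕ) : ℤ) < (w ⟨i, Nat.lt_of_succ_lt hi⟩ : ℕ) := by exact_mod_cast hlt
    omega
  · push Not at hd
    apply hw
    have hmono : StrictMono w := by
      cases n with
      | zero => intro a; exact a.elim0
      | succ m =>
        rw [Fin.strictMono_iff_lt_succ]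
        intro i
        refine lt_of_le_of_ne (hd i (by omega)) fun he => ?_
        have := w.injective he
        simp [Fin.ext_iff] at this
    have : w = 1 := by
      have h2 : (w : Fin n → Fin n) = id := by
        have := Subsingleton.elim (hmono.orderIsoOfSurjective w w.surjective) (OrderIso.refl _)
        funext x
        exact congrArg (fun e : Fin n ≃o Fin n => e x) this
      ext x
      simp [h2]
    exact this ▸ h1

/-- The analogue of `bubble` acting on values instead of positions. -/
def bubbleLeft {n : ℕ} (i : ℕ) (hi : i + 1 < n) (u : Equiv.Perm (Fin n)) : Equiv.Perm (Fin n) :=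
  (bubble i hi u⁻¹)⁻¹

lemma simple_lt_iff {n : ℕ} (i : ℕ) (hi : i + 1 < n) (p q : Fin n)
    (h1 : ¬ (p = ⟨i, Nat.lt_of_succ_lt hi⟩ ∧ q = ⟨i + 1, hi⟩))
    (h2 : ¬ (q = ⟨i, Nat.lt_of_succ_lt hi⟩ ∧ p = ⟨i + 1, hi⟩)) :
    simple i hi p < simple i hi q ↔ p < q := by
  unfold simple
  rw [Equiv.swap_apply_def, Equiv.swap_apply_def]
  simp only [Fin.ext_iff, Fin.lt_def] at *
  split_ifs <;> simp only [] <;> omega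

lemma bubbleLeft_eq {n : ℕ} (i : ℕ) (hi : i + 1 < n) (u : Equiv.Perm (Fin n)) :
    bubbleLeft i hi u = if u⁻¹ ⟨i, Nat.lt_of_succ_lt hi⟩ < u⁻¹ ⟨i + 1, hi⟩ then
      simple i hi * u else u := by
  unfold bubbleLeft bubble
  split_ifs <;> simp [mul_inv_rev, simple_inv]

lemma bubbleLeft_bubble {n : ℕ} (i j : ℕ) (hi : i + 1 < n) (hj : j + 1 < n)
    (u : Equiv.Perm (Fin n)) :
    bubbleLeft i hi (bubble j hj u) = bubble j hj (bubbleLeft i hi u) := by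
  set a : Fin n := ⟨i, Nat.lt_of_succ_lt hi⟩ with ha
  set b : Fin n := ⟨i + 1, hi⟩ with hb
  set c : Fin n := ⟨j, Nat.lt_of_succ_lt hj⟩ with hc
  set d : Fin n := ⟨j + 1, hj⟩ with hd
  have hab : a < b := by simp [ha, hb]
  have hcd : c < d := by simp [hc, hd]
  have sa : simple i hi a = b := Equiv.swap_apply_left _ _
  have sb : simple i hi b = a := Equiv.swap_apply_right _ _
  have sc : simple j hj c = d := Equiv.swap_apply_left _ _
  have sd : simple j hj d = c := Equiv.swap_apply_right _ _
  by_cases h1 : u c = a ∧ u d = b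
  · obtain ⟨hu1, hu2⟩ := h1
    have hi1 : u⁻¹ a = c := by rw [← hu1]; simp
    have hi2 : u⁻¹ b = d := by rw [← hu2]; simp
    have hE : simple i hi * u = u * simple j hj := by
      have : simple i hi = Equiv.swap (u c) (u d) := by rw [hu1, hu2]; rfl
      rw [this, Equiv.swap_apply_apply]
      simp [simple, hc, hd]
    have e1 : bubble j hj u = u * simple j hj := by
      unfold bubble; rw [if_pos]; change u c < u d; rw [hu1, hu2]; exact hab
    have e2 : bubbleLeft i hi u = simple i hi * u := by
      rw [bubbleLeft_eq, if_pos]; change u⁻¹ a < u⁻¹ b; rw [hi1, hi2]; exact hcd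
    rw [e1, e2, bubbleLeft_eq, if_neg, hE]
    · unfold bubble
      rw [if_neg]
      change ¬ (u (simple j hj c) < u (simple j hj d))
      rw [sc, sd, hu1, hu2]; exact hab.not_gt
    · change ¬ ((u * simple j hj)⁻¹ a < (u * simple j hj)⁻¹ b)
      rw [mul_inv_rev, simple_inv, Equiv.Perm.mul_apply, Equiv.Perm.mul_apply, hi1, hi2, sc, sd]
      exact hcd.not_gt
  by_cases h2 : u d = a ∧ u c = b
  · obtain ⟨hu1, hu2⟩ := h2
    have hi1 : u⁻¹ a = d := by rw [← hu1]; simp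
    have hi2 : u⁻¹ b = c := by rw [← hu2]; simp
    have e1 : bubble j hj u = u := by
      unfold bubble; rw [if_neg]; change ¬ (u c < u d); rw [hu1, hu2]; exact hab.not_gt
    have e2 : bubbleLeft i hi u = u := by
      rw [bubbleLeft_eq, if_neg]; change ¬ (u⁻¹ a < u⁻¹ b); rw [hi1, hi2]; exact hcd.not_gt
    rw [e1, e2, e1]
  have hL : (u * simple j hj)⁻¹ a < (u * simple j hj)⁻¹ b ↔ u⁻¹ a < u⁻¹ b := by
    rw [mul_inv_rev, simple_inv, Equiv.Perm.mul_apply, Equiv.Perm.mul_apply]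
    apply simple_lt_iff
    · rintro ⟨p, q⟩
      exact h1 ⟨(Equiv.Perm.inv_eq_iff_eq.mp p).symm, (Equiv.Perm.inv_eq_iff_eq.mp q).symm⟩
    · rintro ⟨p, q⟩
      exact h2 ⟨(Equiv.Perm.inv_eq_iff_eq.mp q).symm, (Equiv.Perm.inv_eq_iff_eq.mp p).symm⟩
  have hR : (simple i hi * u) c < (simple i hi * u) d ↔ u c < u d := by
    rw [Equiv.Perm.mul_apply, Equiv.Perm.mul_apply]
    apply simple_lt_iff
    · exact h1
    · exact h2
  by_cases hp : u c < u d
  · by_cases hq : u⁻¹ a < u⁻¹ b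
    · rw [bubbleLeft_eq i hi u, if_pos hq]
      unfold bubble
      rw [if_pos hp, if_pos (hR.2 hp), bubbleLeft_eq, if_pos (hL.2 hq), mul_assoc]
    · rw [bubbleLeft_eq i hi u, if_neg hq]
      unfold bubble
      rw [if_pos hp, bubbleLeft_eq, if_neg (fun h => hq (hL.1 h))]
  · by_cases hq : u⁻¹ a < u⁻¹ b
    · rw [bubbleLeft_eq i hi u, if_pos hq]
      unfold bubble
      rw [if_neg hp, if_neg (fun h => hp (hR.1 h)), bubbleLeft_eq, if_pos hq]
    · rw [bubbleLeft_eq i hi u, if_neg hq]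
      unfold bubble
      rw [if_neg hp, bubbleLeft_eq, if_neg hq]

/-- The operators `bubble` indexed by the letters of a word, applied from left to right. -/
def bubbleWord {n : ℕ} (w : List {i : ℕ // i + 1 < n}) (u : Equiv.Perm (Fin n)) :
    Equiv.Perm (Fin n) :=
  w.foldl (fun x i => bubble i.1 i.2 x) u

lemma bubbleWord_append {n : ℕ} (w w' : List {i : ℕ // i + 1 < n}) (u : Equiv.Perm (Fin n)) :
    bubbleWord (w ++ w') u = bubbleWord w' (bubbleWord w u) := List.foldl_append

lemma bubbleLeft_bubbleWord {n : ℕ} (i : ℕ) (hi : i + 1 < n) (w : List {i : ℕ // i + 1 < n})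
    (u : Equiv.Perm (Fin n)) :
    bubbleLeft i hi (bubbleWord w u) = bubbleWord w (bubbleLeft i hi u) := by
  induction w generalizing u with
  | nil => rfl
  | cons j w ih =>
    change bubbleLeft i hi (bubbleWord w _) = bubbleWord w _
    rw [ih, bubbleLeft_bubble]

lemma exists_bubbleWord {n : ℕ} (v : Equiv.Perm (Fin n)) :
    ∃ w : List {i : ℕ // i + 1 < n}, bubbleWord w 1 = v := by
  induction v using bubble_induction with
  | h1 => exact ⟨[], rfl⟩
  | h i hi u ih =>
    obtain ⟨w, hw⟩ := ih
    exact ⟨w ++ [⟨i, hi⟩], by rw [bubbleWord_append, hw]; rfl⟩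

lemma bubbleWord_congr {n : ℕ} {w w' : List {i : ℕ // i + 1 < n}}
    (h : bubbleWord w 1 = bubbleWord w' 1) (u : Equiv.Perm (Fin n)) :
    bubbleWord w u = bubbleWord w' u := by
  suffices H : ∀ x : Equiv.Perm (Fin n), bubbleWord w x⁻¹ = bubbleWord w' x⁻¹ by
    simpa using H u⁻¹
  intro x
  induction x using bubble_induction with
  | h1 => simpa using h
  | h i hi x ih =>
    have : (bubble i hi x)⁻¹ = bubbleLeft i hi x⁻¹ := by simp [bubbleLeft]
    rw [this, ← bubbleLeft_bubbleWord, ← bubbleLeft_bubbleWord, ih]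

/-- There is exactly one Demazure product on each symmetric group. -/
theorem existsUnique_isDemazureMul (n : ℕ) :
    ∃! op : Equiv.Perm (Fin n) → Equiv.Perm (Fin n) → Equiv.Perm (Fin n), IsDemazureMul op := by
  choose word hword using exists_bubbleWord (n := n)
  refine ⟨fun u v => bubbleWord (word v) u, ⟨?_, ?_, ?_, ?_⟩, ?_⟩
  · intro u v w
    rw [← bubbleWord_append]
    apply bubbleWord_congr
    rw [bubbleWord_append, hword, hword]
  · intro u
    exact hword u
  · intro u
    exact bubbleWord_congr (w' := []) (hword 1) u
  · intro u i hi
    refine bubbleWord_congr (w' := [⟨i, hi⟩]) ?_ u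
    rw [hword]
    change _ = bubble i hi 1
    unfold bubble
    rw [if_pos (by simp)]
    simp
  · intro op hop
    funext u v
    suffices H : ∀ w : List {i : ℕ // i + 1 < n}, op u (bubbleWord w 1) = bubbleWord w u by
      rw [← hword v, H, hword v]
    intro w
    induction w using List.reverseRecOn with
    | nil => exact hop.one_right u
    | append_singleton w i ih =>
      rw [bubbleWord_append, bubbleWord_append]
      change op u (bubble i.1 i.2 _) = bubble i.1 i.2 _
      rw [← ih, ← hop.simple_right, ← hop.simple_right, hop.assoc]

/-- The Demazure product of two permutations. -/
noncomputable def demazureMul {n : ℕ} : Equiv.Perm (Fin n) → Equiv.Perm (Fin n) →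
    Equiv.Perm (Fin n) :=
  Classical.choose (existsUnique_isDemazureMul n).exists

lemma isDemazureMul_demazureMul (n : ℕ) : IsDemazureMul (demazureMul (n := n)) :=
  Classical.choose_spec (existsUnique_isDemazureMul n).exists

/-! ### Permutons -/

/-- A probability measure on the unit square with uniform marginals. -/
def IsPermuton (μ : ProbabilityMeasure (I × I)) : Prop :=
  ∀ a b : I, a ≤ b →
    (μ : Measure (I × I)) (univ ×ˢ Icc a b) = ENNReal.ofReal (b - a) ∧
    (μ : Measure (I × I)) (Icc a b ×ˢ univ) = ENNReal.ofReal (b - a)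

/-- Permutons, with the topology of weak convergence of probability measures (the subspace
topology coming from `ProbabilityMeasure (I × I)`). -/
abbrev Permuton : Type := {μ : ProbabilityMeasure (I × I) // IsPermuton μ}

/-- The height function of a permuton, `(x, y) ↦ μ ([x, 1] × [0, y])`. -/
noncomputable def height (μ : Permuton) (x y : I) : ℝ :=
  (μ.1 : Measure (I × I)).real (Icc x 1 ×ˢ Icc 0 y)

/-- `ρ` is a Demazure product of the permutons `μ` and `ν`: its height function at `(x, y)` is the
(attained) minimum over `γ` of `H_μ (γ, y) + H_ν (x, γ)`. -/
def IsDemazureProduct (μ ν ρ : Permuton) : Prop :=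
  ∀ x y : I, IsLeast (range fun γ : I => height μ γ y + height ν x γ) (height ρ x y)

/-- The interval `[k / n, (k + 1) / n]`, for `k` in `{0, …, n - 1}`. -/
def cell {n : ℕ} (k : Fin n) : Set I :=
  {x : I | (k : ℝ) ≤ n * (x : ℝ) ∧ n * (x : ℝ) ≤ (k : ℝ) + 1}

/-- The measure with density `n` on the union of the squares of side length `1 / n` attached to the
points of the plot of `u`, and with density `0` elsewhere. The element `k` of `Fin n` stands for
the element `k + 1` of `{1, …, n}`. -/
noncomputable def plotMeasure {n : ℕ} (u : Equiv.Perm (Fin n)) : Measure (I × I) :=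
  (n : ℝ≥0∞) • volume.restrict (⋃ k : Fin n, cell k ×ˢ cell (u k))

lemma cell_eq {n : ℕ} (k : Fin n) :
    ∃ (a b : I), (a : ℝ) = k / n ∧ (b : ℝ) = (k + 1) / n ∧ cell k = Icc a b := by
  have hn : (0 : ℝ) < n := by exact_mod_cast k.pos
  have hk : (k : ℝ) + 1 ≤ n := by exact_mod_cast k.2
  have hk0 : (0 : ℝ) ≤ k := by positivity
  refine ⟨⟨k / n, by positivity, by rw [div_le_one hn]; linarith⟩,
    ⟨(k + 1) / n, by positivity, by rw [div_le_one hn]; linarith⟩, rfl, rfl, ?_⟩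
  ext x
  simp only [cell, mem_ofPred_eq, mem_Icc, ← Subtype.coe_le_coe, div_le_iff₀ hn, le_div_iff₀ hn,
    mul_comm]

lemma measurableSet_cell {n : ℕ} (k : Fin n) : MeasurableSet (cell k) := by
  obtain ⟨a, b, -, -, h⟩ := cell_eq k
  rw [h]; exact measurableSet_Icc

lemma volume_cell {n : ℕ} (k : Fin n) : (n : ℝ≥0∞) * volume (cell k) = 1 := by
  obtain ⟨a, b, ha, hb, h⟩ := cell_eq k
  have hn : (0 : ℝ) < n := by exact_mod_cast k.pos
  rw [h, unitInterval.volume_Icc, ha, hb, ← ENNReal.ofReal_natCast, ← ENNReal.ofReal_mul hn.le,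
    ← ENNReal.ofReal_one]
  congr 1
  field_simp
  ring

lemma aedisjoint_cell {n : ℕ} : Pairwise (Function.onFun (AEDisjoint volume) (cell (n := n))) := by
  intro j k hjk
  have hn : (0 : ℝ) < n := by exact_mod_cast k.pos
  have hsub : (cell j ∩ cell k).Subsingleton := by
    rintro x ⟨hx1, hx2⟩ y ⟨hy1, hy2⟩
    simp only [cell, mem_ofPred_eq] at hx1 hx2 hy1 hy2
    have hnx : (n : ℝ) * x = n * y := by
      rcases lt_or_gt_of_ne hjk with h | h
      · have : (j : ℝ) + 1 ≤ k := by exact_mod_cast h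
        linarith
      · have : (k : ℝ) + 1 ≤ j := by exact_mod_cast h
        linarith
    exact Subtype.ext (mul_left_cancel₀ hn.ne' hnx)
  exact hsub.measure_zero _

lemma iUnion_cell {n : ℕ} [NeZero n] : (⋃ k : Fin n, cell k) = univ := by
  have hn : (0 : ℝ) < n := by exact_mod_cast Nat.pos_of_ne_zero (NeZero.ne n)
  rw [eq_univ_iff_forall]
  intro x
  rw [mem_iUnion]
  by_cases h : (x : ℝ) = 1
  · refine ⟨⟨n - 1, Nat.sub_lt (Nat.pos_of_ne_zero (NeZero.ne n)) one_pos⟩, ?_⟩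
    have h1 : ((n - 1 : ℕ) : ℝ) = n - 1 := by
      rw [Nat.cast_sub (Nat.one_le_iff_ne_zero.2 (NeZero.ne n))]; simp
    simp only [cell, mem_ofPred_eq, h, h1]
    constructor <;> linarith
  · have hx0 : 0 ≤ (n : ℝ) * x := mul_nonneg hn.le x.2.1
    have hx1 : (n : ℝ) * x < n := by
      have := lt_of_le_of_ne x.2.2 h
      nlinarith
    refine ⟨⟨⌊(n : ℝ) * x⌋₊, (Nat.floor_lt hx0).2 hx1⟩, Nat.floor_le hx0, (Nat.lt_floor_add_one _).le⟩

lemma sum_volume_cell_inter {n : ℕ} [NeZero n] {s : Set I} (hs : MeasurableSet s) :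
    ∑ k : Fin n, volume (cell k ∩ s) = volume s := by
  rw [← tsum_fintype (L := .unconditional _), ← measure_iUnion₀, ← iUnion_inter, iUnion_cell, univ_inter]
  · intro j k hjk
    exact (aedisjoint_cell hjk).mono inter_subset_left inter_subset_left
  · exact fun k => ((measurableSet_cell k).inter hs).nullMeasurableSet

lemma plotMeasure_prod {n : ℕ} (u : Equiv.Perm (Fin n)) {s t : Set I}
    (hs : MeasurableSet s) (ht : MeasurableSet t) :
    plotMeasure u (s ×ˢ t) =
      ∑ k : Fin n, n * (volume (cell k ∩ s) * volume (cell (u k) ∩ t)) := by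
  unfold plotMeasure
  rw [Measure.smul_apply, Measure.restrict_apply (hs.prod ht), inter_comm, iUnion_inter,
    measure_iUnion₀, tsum_fintype, smul_eq_mul, Finset.mul_sum]
  · refine Finset.sum_congr rfl fun k _ => ?_
    rw [prod_inter_prod, Measure.volume_eq_prod, Measure.prod_prod]
  · intro j k hjk
    have h : volume ((cell j ∩ cell k) ×ˢ (univ : Set I)) = 0 := by
      rw [Measure.volume_eq_prod, Measure.prod_prod, aedisjoint_cell hjk, zero_mul]
    refine measure_mono_null ?_ h
    rintro x ⟨hx, hx'⟩
    exact ⟨⟨hx.1.1, hx'.1.1⟩, trivial⟩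
  · exact fun k => (((measurableSet_cell k).prod (measurableSet_cell _)).inter
      (hs.prod ht)).nullMeasurableSet

lemma plotMeasure_univ_prod {n : ℕ} [NeZero n] (u : Equiv.Perm (Fin n)) {t : Set I}
    (ht : MeasurableSet t) : plotMeasure u (univ ×ˢ t) = volume t := by
  rw [plotMeasure_prod u MeasurableSet.univ ht, ← sum_volume_cell_inter (n := n) ht,
    ← Equiv.sum_comp u fun k => volume (cell k ∩ t)]
  refine Finset.sum_congr rfl fun k _ => ?_
  rw [inter_univ, ← mul_assoc, volume_cell, one_mul]

lemma plotMeasure_prod_univ {n : ℕ} [NeZero n] (u : Equiv.Perm (Fin n)) {s : Set I}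
    (hs : MeasurableSet s) : plotMeasure u (s ×ˢ univ) = volume s := by
  rw [plotMeasure_prod u hs MeasurableSet.univ, ← sum_volume_cell_inter (n := n) hs]
  refine Finset.sum_congr rfl fun k _ => ?_
  rw [inter_univ, mul_left_comm, volume_cell, mul_one]

lemma isProbabilityMeasure_plotMeasure {n : ℕ} [NeZero n] (u : Equiv.Perm (Fin n)) :
    IsProbabilityMeasure (plotMeasure u) :=
  ⟨by rw [← univ_prod_univ, plotMeasure_univ_prod u MeasurableSet.univ, measure_univ]⟩

/-- The permuton attached to a permutation of a nonempty finite set `{1, …, n}`. -/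
noncomputable def ofPerm {n : ℕ} [NeZero n] (u : Equiv.Perm (Fin n)) : Permuton :=
  ⟨⟨plotMeasure u, isProbabilityMeasure_plotMeasure u⟩, fun a b _ =>
    ⟨by
      change plotMeasure u _ = _
      rw [plotMeasure_univ_prod u measurableSet_Icc, unitInterval.volume_Icc], by
      change plotMeasure u _ = _
      rw [plotMeasure_prod_univ u measurableSet_Icc, unitInterval.volume_Icc]⟩⟩

/-- The identity permuton: the uniform measure on the diagonal of the unit square. -/
noncomputable def identity : Permuton :=
  ⟨⟨(volume : Measure I).map fun x => (x, x),
      Measure.isProbabilityMeasure_map (by fun_prop)⟩, fun a b _ =>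
    ⟨by
      change (volume : Measure I).map (fun x => (x, x)) _ = _
      rw [Measure.map_apply (by fun_prop) (MeasurableSet.univ.prod measurableSet_Icc),
        ← unitInterval.volume_Icc]
      congr 1
      ext x
      simp, by
      change (volume : Measure I).map (fun x => (x, x)) _ = _
      rw [Measure.map_apply (by fun_prop) (measurableSet_Icc.prod MeasurableSet.univ),
        ← unitInterval.volume_Icc]
      congr 1
      ext x
      simp⟩⟩

end DemazurePermuton

/-! The problem is moved from measures to height functions. In `IsHeight`, the rectangle inequality
says that rectangles have nonnegative mass, and the boundary values encode the uniform marginals;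
together they make such functions 1-Lipschitz in each variable. A height function determines its
permuton (`height_injective`), and since the space of permutons is compact, weak convergence is the
same as pointwise convergence of height functions (`tendsto_iff_height`). Conversely, every function
satisfying `IsHeight` comes from a permuton (`IsHeight.exists_height_eq`), obtained as a limit of
permutons with the right height on finer and finer grids.

After this translation the product is the min-plus product. The minimum is attained by continuity,
and an uncrossing of minimizers shows that the rectangle inequality survives
(`IsHeight.minPlus_isHeight`), which gives existence; uniqueness is injectivity. Associativity is an
interchange of two minima, and the identity laws express monotonicity and the Lipschitz bound.

For permutations the min-plus formula holds exactly for the counting functions `permHeight`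
(`isLeast_permHeight_demazureMul`). The proof is an induction on `v` through the operators `bubble`:
each changes a single row of `permHeight`, by an operation that commutes with min-plus
multiplication on the left. At scale `1 / n`, the heights of the associated permutons therefore
satisfy the formula up to a multiple of `1 / n`, and compactness lets this pass to the limit. -/

namespace DemazurePermuton

/-! ### Height functions -/

/-- The boundary values and the rectangle inequality that characterize height functions. -/
structure IsHeight (K : I → I → ℝ) : Prop where
  zero_right : ∀ x, K x 0 = 0
  one_right : ∀ x, K x 1 = 1 - x
  zero_left : ∀ y, K 0 y = y
  one_left : ∀ y, K 1 y = 0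
  rect : ∀ x x' y y', x ≤ x' → y ≤ y' → K x y + K x' y' ≤ K x y' + K x' y

namespace IsHeight

variable {K L : I → I → ℝ}

lemma anti_left (hK : IsHeight K) {x x' : I} (h : x ≤ x') (y : I) : K x' y ≤ K x y := by
  have := hK.rect x x' 0 y h (unitInterval.nonneg y)
  rw [hK.zero_right, hK.zero_right] at this
  linarith

lemma mono_right (hK : IsHeight K) (x : I) {y y' : I} (h : y ≤ y') : K x y ≤ K x y' := by
  have := hK.rect x 1 y y' (unitInterval.le_one x) h
  rw [hK.one_left, hK.one_left] at this
  linarith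

/-- For `x ≤ x'` this is the rectangle inequality on the strip reaching up to height 1, where `K` is
`1 - x`: the strip of width `x' - x` carries no more mass than its width. -/
lemma left_le_add (hK : IsHeight K) (x x' y : I) : K x y ≤ K x' y + |(x : ℝ) - x'| := by
  rcases le_total x x' with h | h
  · have h1 := hK.rect x x' y 1 h (unitInterval.le_one y)
    rw [hK.one_right, hK.one_right] at h1
    have := neg_abs_le ((x : ℝ) - x')
    linarith
  · have := hK.anti_left h y
    have := abs_nonneg ((x : ℝ) - x')
    linarith

lemma right_le_add (hK : IsHeight K) (x y y' : I) : K x y ≤ K x y' + |(y : ℝ) - y'| := by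
  rcases le_total y' y with h | h
  · have h1 := hK.rect 0 x y' y (unitInterval.nonneg x) h
    rw [hK.zero_left, hK.zero_left] at h1
    have := le_abs_self ((y : ℝ) - y')
    linarith
  · have := hK.mono_right x h
    have := abs_nonneg ((y : ℝ) - y')
    linarith

lemma le_add (hK : IsHeight K) (x x' y y' : I) :
    K x y ≤ K x' y' + |(x : ℝ) - x'| + |(y : ℝ) - y'| := by
  have := hK.left_le_add x x' y
  have := hK.right_le_add x' y y'
  linarith

lemma nonneg (hK : IsHeight K) (x y : I) : 0 ≤ K x y := by
  rw [← hK.zero_right x]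
  exact hK.mono_right x (unitInterval.nonneg y)

/-- With `nonneg`, this makes `max (y - x) 0`, the height function of the identity permuton, a lower
bound for all height functions. -/
lemma sub_le (hK : IsHeight K) (x y : I) : (y : ℝ) - x ≤ K x y := by
  have h := hK.left_le_add 0 x y
  rw [hK.zero_left] at h
  have hx : |((0 : I) : ℝ) - x| = x := by
    rw [abs_sub_comm]; simp [abs_of_nonneg x.2.1]
  linarith

lemma continuous_left (hK : IsHeight K) (y : I) : Continuous fun x => K x y := by
  refine (LipschitzWith.of_le_add (α := I) fun x x' => ?_).continuous
  exact hK.left_le_add x x' y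

lemma continuous_right (hK : IsHeight K) (x : I) : Continuous fun y => K x y := by
  refine (LipschitzWith.of_le_add (α := I) fun y y' => ?_).continuous
  exact hK.right_le_add x y y'

end IsHeight

/-! ### The space of permutons -/

lemma map_fst (μ : Permuton) : (μ.1 : Measure (I × I)).map Prod.fst = volume := by
  have : IsFiniteMeasure ((μ.1 : Measure (I × I)).map Prod.fst) :=
    Measure.isFiniteMeasure_map _ _
  refine Measure.ext_of_Iic _ _ fun a => ?_
  rw [Measure.map_apply measurable_fst measurableSet_Iic, ← prod_univ]
  have h := (μ.2 0 a (unitInterval.nonneg a)).2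
  rw [unitInterval.volume_Iic]
  convert h using 2
  · congr 1
    ext x
    simp
  · simp

lemma map_snd (μ : Permuton) : (μ.1 : Measure (I × I)).map Prod.snd = volume := by
  have : IsFiniteMeasure ((μ.1 : Measure (I × I)).map Prod.snd) :=
    Measure.isFiniteMeasure_map _ _
  refine Measure.ext_of_Iic _ _ fun a => ?_
  rw [Measure.map_apply measurable_snd measurableSet_Iic, ← univ_prod]
  have h := (μ.2 0 a (unitInterval.nonneg a)).1
  rw [unitInterval.volume_Iic]
  convert h using 2
  · congr 1
    ext x
    simp
  · simp

lemma measure_prod_univ (μ : Permuton) {s : Set I} (hs : MeasurableSet s) :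
    (μ.1 : Measure (I × I)) (s ×ˢ univ) = volume s := by
  rw [← map_fst μ, Measure.map_apply measurable_fst hs, prod_univ]

lemma measure_univ_prod (μ : Permuton) {s : Set I} (hs : MeasurableSet s) :
    (μ.1 : Measure (I × I)) (univ ×ˢ s) = volume s := by
  rw [← map_snd μ, Measure.map_apply measurable_snd hs, univ_prod]

lemma isPermuton_of_map_eq {μ : ProbabilityMeasure (I × I)}
    (h1 : (μ : Measure (I × I)).map Prod.fst = volume)
    (h2 : (μ : Measure (I × I)).map Prod.snd = volume) : IsPermuton μ := by
  refine fun a b _ => ⟨?_, ?_⟩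
  · rw [univ_prod, ← Measure.map_apply measurable_snd measurableSet_Icc, h2,
      unitInterval.volume_Icc]
  · rw [prod_univ, ← Measure.map_apply measurable_fst measurableSet_Icc, h1,
      unitInterval.volume_Icc]

/-- Having uniform marginals means that two pushforwards, both weakly continuous in the measure,
equal a fixed measure. -/
lemma isClosed_setOf_isPermuton : IsClosed {μ : ProbabilityMeasure (I × I) | IsPermuton μ} := by
  let v : ProbabilityMeasure I := ⟨volume, inferInstance⟩
  have hfst : Continuous fun μ : ProbabilityMeasure (I × I) => μ.map (measurable_fst.aemeasurable) :=
    ProbabilityMeasure.continuous_map continuous_fst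
  have hsnd : Continuous fun μ : ProbabilityMeasure (I × I) => μ.map (measurable_snd.aemeasurable) :=
    ProbabilityMeasure.continuous_map continuous_snd
  have : {μ : ProbabilityMeasure (I × I) | IsPermuton μ} =
      {μ | μ.map (measurable_fst.aemeasurable) = v} ∩
        {μ | μ.map (measurable_snd.aemeasurable) = v} := by
    ext μ
    constructor
    · exact fun h => ⟨Subtype.ext (map_fst ⟨μ, h⟩), Subtype.ext (map_snd ⟨μ, h⟩)⟩
    · exact fun h => isPermuton_of_map_eq (congrArg Subtype.val h.1) (congrArg Subtype.val h.2)
  rw [this]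
  exact (isClosed_eq hfst continuous_const).inter (isClosed_eq hsnd continuous_const)

instance : CompactSpace Permuton :=
  isCompact_iff_compactSpace.1 isClosed_setOf_isPermuton.isCompact

lemma Icc_zero_eq_Iic (a : I) : Icc 0 a = Iic a := by
  ext x
  simp

lemma Icc_one_eq_Ici (a : I) : Icc a 1 = Ici a := by
  ext x
  exact ⟨fun h => h.1, fun h => ⟨h, x.2.2⟩⟩

lemma isHeight_height (μ : Permuton) : IsHeight (height μ) where
  zero_right x := by
    have h : (μ.1 : Measure (I × I)) (Icc x 1 ×ˢ Icc 0 0) = 0 := by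
      refine measure_mono_null (prod_mono (subset_univ _) Subset.rfl) ?_
      rw [measure_univ_prod μ measurableSet_Icc]
      simp
    simp only [height, measureReal_def, h, ENNReal.toReal_zero]
  one_right x := by
    have h1 : (Icc 0 1 : Set I) = univ := eq_univ_of_forall fun y => ⟨y.2.1, y.2.2⟩
    rw [height, measureReal_def, h1, measure_prod_univ μ measurableSet_Icc,
      unitInterval.volume_Icc, ENNReal.toReal_ofReal]
    · simp
    · simpa using x.2.2
  zero_left y := by
    have h1 : (Icc 0 1 : Set I) = univ := eq_univ_of_forall fun y => ⟨y.2.1, y.2.2⟩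
    rw [height, measureReal_def, h1, measure_univ_prod μ measurableSet_Icc,
      unitInterval.volume_Icc, ENNReal.toReal_ofReal]
    · simp
    · simpa using y.2.1
  one_left y := by
    have h : (μ.1 : Measure (I × I)) (Icc 1 1 ×ˢ Icc 0 y) = 0 := by
      refine measure_mono_null (prod_mono Subset.rfl (subset_univ _)) ?_
      rw [measure_prod_univ μ measurableSet_Icc]
      simp
    simp only [height, measureReal_def, h, ENNReal.toReal_zero]
  rect x x' y y' hx hy := by
    unfold height
    have hm : ∀ a b : I, MeasurableSet (Icc a 1 ×ˢ Icc 0 b) := fun a b =>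
      measurableSet_Icc.prod measurableSet_Icc
    rw [← measureReal_union_add_inter (hm x' y')]
    refine add_le_add (measureReal_mono ?_) (measureReal_mono ?_)
    · exact union_subset (prod_mono Subset.rfl (Icc_subset_Icc_right hy))
        (prod_mono (Icc_subset_Icc_left hx) Subset.rfl)
    · rw [prod_inter_prod]
      exact prod_mono inter_subset_right inter_subset_left

/-- The boundary of the rectangle lies in a vertical and a horizontal line, which are null because
the marginals have no atoms, so the portmanteau theorem applies. -/
lemma continuous_height (x y : I) : Continuous fun μ : Permuton => height μ x y := by
  rw [continuous_iff_continuousAt]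
  intro μ
  have hnull : (μ.1 : Measure (I × I)) (frontier (Icc x 1 ×ˢ Icc 0 y)) = 0 := by
    rw [frontier_prod_eq, Icc_one_eq_Ici, Icc_zero_eq_Iic]
    refine measure_union_null ?_ ?_
    · refine measure_mono_null (prod_mono (subset_univ _) (frontier_Iic_subset y)) ?_
      rw [measure_univ_prod μ (measurableSet_singleton _)]
      simp
    · refine measure_mono_null (prod_mono (frontier_Ici_subset x) (subset_univ _)) ?_
      rw [measure_prod_univ μ (measurableSet_singleton _)]
      simp
  have h := ProbabilityMeasure.tendsto_measure_of_null_frontier_of_tendsto'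
    (continuous_subtype_val.tendsto μ) hnull
  exact (ENNReal.tendsto_toReal (measure_ne_top _ _)).comp h

/-- Half-lines determine finite measures on the interval. This is applied one coordinate at a time:
first with `Iic y` frozen, then with an arbitrary measurable set `s` frozen. -/
lemma height_injective : Function.Injective height := by
  intro μ ν h
  have h0 : ∀ x y : I, (μ.1 : Measure (I × I)) (Ici x ×ˢ Iic y) =
      (ν.1 : Measure (I × I)) (Ici x ×ˢ Iic y) := by
    intro x y
    have := congrFun (congrFun h x) y
    simp only [height, measureReal_def, Icc_zero_eq_Iic, Icc_one_eq_Ici] at this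
    exact (ENNReal.toReal_eq_toReal_iff' (measure_ne_top _ _) (measure_ne_top _ _)).1 this
  have h1 : ∀ {s : Set I} (y : I), MeasurableSet s → (μ.1 : Measure (I × I)) (s ×ˢ Iic y) =
      (ν.1 : Measure (I × I)) (s ×ˢ Iic y) := by
    intro s y hs
    have key : ((μ.1 : Measure (I × I)).restrict (univ ×ˢ Iic y)).map Prod.fst =
        ((ν.1 : Measure (I × I)).restrict (univ ×ˢ Iic y)).map Prod.fst := by
      refine Measure.ext_of_Ici _ _ fun x => ?_
      rw [Measure.map_apply measurable_fst measurableSet_Ici,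
        Measure.map_apply measurable_fst measurableSet_Ici, ← prod_univ,
        Measure.restrict_apply (measurableSet_Ici.prod MeasurableSet.univ),
        Measure.restrict_apply (measurableSet_Ici.prod MeasurableSet.univ), prod_inter_prod,
        inter_univ, univ_inter, h0]
    have := congrArg (fun m : Measure I => m s) key
    simpa only [Measure.map_apply measurable_fst hs, ← prod_univ,
      Measure.restrict_apply (hs.prod MeasurableSet.univ), prod_inter_prod,
      inter_univ, univ_inter] using this
  have h2 : ∀ s t : Set I, MeasurableSet s → MeasurableSet t →
      (μ.1 : Measure (I × I)) (s ×ˢ t) = (ν.1 : Measure (I × I)) (s ×ˢ t) := by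
    intro s t hs ht
    have key : ((μ.1 : Measure (I × I)).restrict (s ×ˢ univ)).map Prod.snd =
        ((ν.1 : Measure (I × I)).restrict (s ×ˢ univ)).map Prod.snd := by
      refine Measure.ext_of_Iic _ _ fun x => ?_
      rw [Measure.map_apply measurable_snd measurableSet_Iic,
        Measure.map_apply measurable_snd measurableSet_Iic, ← univ_prod,
        Measure.restrict_apply (MeasurableSet.univ.prod measurableSet_Iic),
        Measure.restrict_apply (MeasurableSet.univ.prod measurableSet_Iic), prod_inter_prod,
        inter_univ, univ_inter, h1 x hs]
    have := congrArg (fun m : Measure I => m t) key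
    simpa only [Measure.map_apply measurable_snd ht, ← univ_prod,
      Measure.restrict_apply (MeasurableSet.univ.prod ht), prod_inter_prod,
      inter_univ, univ_inter] using this
  have h3 : (μ.1 : Measure (I × I)) = (ν.1 : Measure (I × I)) :=
    Measure.ext_prod fun {s t} hs ht => h2 s t hs ht
  exact Subtype.ext (Subtype.ext h3)

/-- Weak convergence of permutons is pointwise convergence of height functions. -/
lemma tendsto_iff_height {ι : Type*} {l : Filter ι} {μ : ι → Permuton} {ρ : Permuton} :
    Tendsto μ l (𝓝 ρ) ↔ ∀ x y, Tendsto (fun i => height (μ i) x y) l (𝓝 (height ρ x y)) := by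
  have hc : Continuous height := continuous_pi fun x => continuous_pi fun y => continuous_height x y
  -- A continuous injection from a compact space to a Hausdorff space is a closed embedding.
  rw [(hc.isClosedEmbedding height_injective).isEmbedding.tendsto_nhds_iff, tendsto_pi_nhds]
  simp only [tendsto_pi_nhds]
  rfl

/-! ### Grid points -/

/-- The point `i / n` of the unit interval, for `i ≤ n`. -/
noncomputable def gridPt (n i : ℕ) : I := projIcc 0 1 zero_le_one ((i : ℝ) / n)

lemma coe_gridPt {n i : ℕ} (hi : i ≤ n) : (gridPt n i : ℝ) = i / n := by
  have h : ((i : ℝ) / n) ∈ Icc (0 : ℝ) 1 :=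
    ⟨by positivity, div_le_one_of_le₀ (by exact_mod_cast hi) (by positivity)⟩
  rw [gridPt, projIcc_of_mem _ h]

lemma gridPt_zero (n : ℕ) : gridPt n 0 = 0 :=
  Subtype.ext (by rw [coe_gridPt (Nat.zero_le n)]; simp)

lemma gridPt_self (n : ℕ) [NeZero n] : gridPt n n = 1 :=
  Subtype.ext (by
    rw [coe_gridPt le_rfl]
    exact div_self (by exact_mod_cast NeZero.ne n))

lemma gridPt_mono (n : ℕ) : Monotone (gridPt n) := fun i j h =>
  monotone_projIcc _ (by gcongr)

lemma exists_abs_sub_gridPt_le (n : ℕ) [NeZero n] (x : I) :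
    ∃ i ≤ n, |(x : ℝ) - gridPt n i| ≤ 1 / n := by
  have hn : (0 : ℝ) < n := by exact_mod_cast Nat.pos_of_ne_zero (NeZero.ne n)
  have hx : 0 ≤ (n : ℝ) * x := mul_nonneg hn.le x.2.1
  have hle : ⌊(n : ℝ) * x⌋₊ ≤ n :=
    Nat.floor_le_of_le (mul_le_of_le_one_right hn.le x.2.2)
  refine ⟨_, hle, ?_⟩
  rw [coe_gridPt hle, show (x : ℝ) - (⌊(n : ℝ) * x⌋₊ : ℝ) / n = (n * x - ⌊(n : ℝ) * x⌋₊) / n by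
    field_simp, abs_div, abs_of_pos hn]
  gcongr
  rw [abs_le]
  have h1 := Nat.floor_le hx
  have h2 := Nat.lt_floor_add_one ((n : ℝ) * x)
  constructor <;> linarith

/-- Height functions that agree on the grid of mesh `1 / n` are close to each other. -/
lemma IsHeight.le_of_eq_on_grid {K L : I → I → ℝ} (hK : IsHeight K) (hL : IsHeight L) (n : ℕ)
    [NeZero n]
    (h : ∀ i j, i ≤ n → j ≤ n → K (gridPt n i) (gridPt n j) = L (gridPt n i) (gridPt n j))
    (x y : I) : K x y ≤ L x y + 4 * (1 / n) := by
  obtain ⟨i, hi, hxi⟩ := exists_abs_sub_gridPt_le n x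
  obtain ⟨j, hj, hyj⟩ := exists_abs_sub_gridPt_le n y
  -- Two coordinates are moved to the grid in `K` and moved back in `L`, hence four errors of `1 /
  -- n`.
  have h1 := hK.le_add x (gridPt n i) y (gridPt n j)
  have h2 := hL.le_add (gridPt n i) x (gridPt n j) y
  rw [abs_sub_comm _ (x : ℝ), abs_sub_comm _ (y : ℝ)] at h2
  rw [h i j hi hj] at h1
  linarith

lemma volume_cell_inter_Icc_one {n : ℕ} (k : Fin n) {a : ℕ} (ha : a ≤ n) :
    volume (cell k ∩ Icc (gridPt n a) 1) = if a ≤ k then volume (cell k) else 0 := by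
  have hn : (0 : ℝ) < n := by exact_mod_cast k.pos
  have hga : (n : ℝ) * gridPt n a = a := by rw [coe_gridPt ha]; field_simp
  split_ifs with h
  · congr 1
    refine inter_eq_left.2 fun x hx => ⟨?_, x.2.2⟩
    have h' : (a : ℝ) ≤ (k : ℕ) := by exact_mod_cast h
    exact Subtype.coe_le_coe.1 (le_of_mul_le_mul_left (by linarith [hx.1]) hn)
  -- Cells are closed, so the intersection can still contain the endpoint `a / n`.
  · refine measure_mono_null (t := {gridPt n a}) (fun x hx => ?_) (measure_singleton _)
    have h' : ((k : ℕ) : ℝ) + 1 ≤ a := by exact_mod_cast not_le.1 h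
    refine le_antisymm ?_ hx.2.1
    exact Subtype.coe_le_coe.1 (le_of_mul_le_mul_left (by linarith [hx.1.2]) hn)

lemma volume_cell_inter_Icc_zero {n : ℕ} (k : Fin n) {b : ℕ} (hb : b ≤ n) :
    volume (cell k ∩ Icc 0 (gridPt n b)) = if (k : ℕ) < b then volume (cell k) else 0 := by
  have hn : (0 : ℝ) < n := by exact_mod_cast k.pos
  have hgb : (n : ℝ) * gridPt n b = b := by rw [coe_gridPt hb]; field_simp
  split_ifs with h
  · congr 1
    refine inter_eq_left.2 fun x hx => ⟨x.2.1, ?_⟩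
    have h' : ((k : ℕ) : ℝ) + 1 ≤ b := by exact_mod_cast h
    exact Subtype.coe_le_coe.1 (le_of_mul_le_mul_left (by linarith [hx.2]) hn)
  · refine measure_mono_null (t := {gridPt n b}) (fun x hx => ?_) (measure_singleton _)
    have h' : (b : ℝ) ≤ (k : ℕ) := by exact_mod_cast not_lt.1 h
    refine le_antisymm hx.2.2 ?_
    exact Subtype.coe_le_coe.1 (le_of_mul_le_mul_left (by linarith [hx.1.1]) hn)

/-! ### Existence of a permuton with a given height function -/

/-- The mass that a height function gives to a square of the grid. -/
noncomputable def gridMass (K : I → I → ℝ) (n i j : ℕ) : ℝ :=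
  K (gridPt n i) (gridPt n (j + 1)) + K (gridPt n (i + 1)) (gridPt n j)
    - (K (gridPt n i) (gridPt n j) + K (gridPt n (i + 1)) (gridPt n (j + 1)))

lemma IsHeight.gridMass_nonneg {K : I → I → ℝ} (hK : IsHeight K) (n i j : ℕ) :
    0 ≤ gridMass K n i j :=
  sub_nonneg.2 (hK.rect _ _ _ _ (gridPt_mono n i.le_succ) (gridPt_mono n j.le_succ))

lemma sum_range_ite_lt (F : ℕ → ℝ) {b n : ℕ} (h : b ≤ n) :
    ∑ j ∈ Finset.range n, (if j < b then F (j + 1) - F j else 0) = F b - F 0 := by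
  rw [← Finset.sum_filter, ← Finset.sum_range_sub]
  congr 1
  ext j
  simp only [Finset.mem_filter, Finset.mem_range]
  omega

lemma sum_range_ite_le (F : ℕ → ℝ) {a n : ℕ} (h : a ≤ n) :
    ∑ i ∈ Finset.range n, (if a ≤ i then F i - F (i + 1) else 0) = F a - F n := by
  have h1 := sum_range_ite_lt F h
  have h2 := Finset.sum_range_sub F n
  have h3 : ∀ i, (if a ≤ i then F i - F (i + 1) else 0) =
      (if i < a then F (i + 1) - F i else 0) - (F (i + 1) - F i) := by
    intro i
    split_ifs <;> first | omega | ring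
  rw [Finset.sum_congr rfl fun i _ => h3 i, Finset.sum_sub_distrib, h1, h2]
  ring

lemma sum_gridMass_right (K : I → I → ℝ) {n b : ℕ} (hb : b ≤ n) (i : ℕ) :
    ∑ j ∈ Finset.range n, (if j < b then gridMass K n i j else 0) =
      (K (gridPt n i) (gridPt n b) - K (gridPt n i) 0)
        - (K (gridPt n (i + 1)) (gridPt n b) - K (gridPt n (i + 1)) 0) := by
  have := sum_range_ite_lt (fun j => K (gridPt n i) (gridPt n j) - K (gridPt n (i + 1)) (gridPt n j))
    hb
  rw [gridPt_zero] at this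
  rw [sub_sub_sub_comm, ← this]
  refine Finset.sum_congr rfl fun j _ => ?_
  congr 1
  unfold gridMass
  ring

/-- The measure that has constant density on each square of the grid of mesh `1 / n` and gives to
these squares the masses prescribed by `K`. -/
noncomputable def gridMeasure (K : I → I → ℝ) (n : ℕ) : Measure (I × I) :=
  ∑ i : Fin n, ∑ j : Fin n,
    ENNReal.ofReal (gridMass K n i j) • ((n * n : ℝ≥0∞) • volume.restrict (cell i ×ˢ cell j))

lemma gridMeasure_prod (K : I → I → ℝ) (n : ℕ) {s t : Set I} (hs : MeasurableSet s)
    (ht : MeasurableSet t) :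
    gridMeasure K n (s ×ˢ t) = ∑ i : Fin n, ∑ j : Fin n, ENNReal.ofReal (gridMass K n i j) *
      ((n * volume (cell i ∩ s)) * (n * volume (cell j ∩ t))) := by
  simp only [gridMeasure, Measure.finsetSum_apply, Measure.smul_apply, smul_eq_mul]
  refine Finset.sum_congr rfl fun i _ => Finset.sum_congr rfl fun j _ => ?_
  rw [Measure.restrict_apply (hs.prod ht), prod_inter_prod, Measure.volume_eq_prod,
    Measure.prod_prod, inter_comm s, inter_comm t]
  ring

lemma sum_fin_ofReal {f : ℕ → ℝ} (hf : ∀ i, 0 ≤ f i) (n : ℕ) :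
    ∑ i : Fin n, ENNReal.ofReal (f i) = ENNReal.ofReal (∑ i ∈ Finset.range n, f i) := by
  rw [Fin.sum_univ_eq_sum_range fun i => ENNReal.ofReal (f i),
    ENNReal.ofReal_sum_of_nonneg fun i _ => hf i]

lemma sum_ofReal_gridMass_right {K : I → I → ℝ} (hK : IsHeight K) {n : ℕ} (i : Fin n) :
    ∑ j : Fin n, ENNReal.ofReal (gridMass K n i j) = ENNReal.ofReal (1 / n) := by
  have : NeZero n := ⟨i.pos.ne'⟩
  have hi : ((i : ℕ) : ℝ) ≤ n := by exact_mod_cast i.2.le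
  rw [sum_fin_ofReal (f := fun j => gridMass K n i j) fun j => hK.gridMass_nonneg n i j]
  have h := sum_gridMass_right K (le_refl n) i
  rw [Finset.sum_congr rfl fun j hj => if_pos (Finset.mem_range.1 hj)] at h
  rw [h, gridPt_self]
  simp only [hK.one_right, hK.zero_right, coe_gridPt i.2.le, coe_gridPt (Nat.succ_le_of_lt i.2)]
  congr 1
  push_cast
  ring

lemma sum_ofReal_gridMass_left {K : I → I → ℝ} (hK : IsHeight K) {n : ℕ} (j : Fin n) :
    ∑ i : Fin n, ENNReal.ofReal (gridMass K n i j) = ENNReal.ofReal (1 / n) := by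
  have : NeZero n := ⟨j.pos.ne'⟩
  rw [sum_fin_ofReal (f := fun i => gridMass K n i j) fun i => hK.gridMass_nonneg n i j]
  have h := sum_range_ite_le
    (fun i => K (gridPt n i) (gridPt n (j + 1)) - K (gridPt n i) (gridPt n j)) (Nat.zero_le n)
  simp only [Nat.zero_le, if_true, gridPt_zero, gridPt_self, hK.zero_left, hK.one_left,
    coe_gridPt j.2.le, coe_gridPt (Nat.succ_le_of_lt j.2)] at h
  congr 1
  calc _ = _ := Finset.sum_congr rfl fun i _ => by unfold gridMass; ring
    _ = _ := h
    _ = _ := by push_cast; ring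

lemma natCast_mul_ofReal_one_div {n : ℕ} [NeZero n] :
    (n : ℝ≥0∞) * ENNReal.ofReal (1 / n) = 1 := by
  have hn : (n : ℝ) ≠ 0 := by exact_mod_cast NeZero.ne n
  rw [← ENNReal.ofReal_natCast, ← ENNReal.ofReal_mul (by positivity), mul_one_div_cancel hn,
    ENNReal.ofReal_one]

lemma gridMeasure_prod_univ {K : I → I → ℝ} (hK : IsHeight K) {n : ℕ} [NeZero n] {s : Set I}
    (hs : MeasurableSet s) : gridMeasure K n (s ×ˢ univ) = volume s := by
  rw [gridMeasure_prod K n hs MeasurableSet.univ, ← sum_volume_cell_inter (n := n) hs]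
  refine Finset.sum_congr rfl fun i _ => ?_
  simp only [inter_univ, volume_cell, mul_one]
  rw [← Finset.sum_mul, sum_ofReal_gridMass_right hK, ← mul_assoc, mul_comm (ENNReal.ofReal _),
    natCast_mul_ofReal_one_div, one_mul]

lemma gridMeasure_univ_prod {K : I → I → ℝ} (hK : IsHeight K) {n : ℕ} [NeZero n] {t : Set I}
    (ht : MeasurableSet t) : gridMeasure K n (univ ×ˢ t) = volume t := by
  rw [gridMeasure_prod K n MeasurableSet.univ ht, ← sum_volume_cell_inter (n := n) ht,
    Finset.sum_comm]
  refine Finset.sum_congr rfl fun j _ => ?_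
  simp only [inter_univ, volume_cell, one_mul]
  rw [← Finset.sum_mul, sum_ofReal_gridMass_left hK, ← mul_assoc, mul_comm (ENNReal.ofReal _),
    natCast_mul_ofReal_one_div, one_mul]

/-- The permuton that interpolates a height function on the grid of mesh `1 / n`. -/
noncomputable def gridPermuton {K : I → I → ℝ} (hK : IsHeight K) (n : ℕ) [NeZero n] : Permuton :=
  ⟨⟨gridMeasure K n, ⟨by
      rw [← univ_prod_univ, gridMeasure_univ_prod hK MeasurableSet.univ, measure_univ]⟩⟩,
    fun a b _ =>
    ⟨by
      change gridMeasure K n _ = _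
      rw [gridMeasure_univ_prod hK measurableSet_Icc, unitInterval.volume_Icc], by
      change gridMeasure K n _ = _
      rw [gridMeasure_prod_univ hK measurableSet_Icc, unitInterval.volume_Icc]⟩⟩

/-- The height is the total mass of the grid squares in the corner block, and this double sum
telescopes to `K`; the other corner terms vanish by the boundary values. -/
lemma height_gridPermuton {K : I → I → ℝ} (hK : IsHeight K) {n : ℕ} [NeZero n] {a b : ℕ}
    (ha : a ≤ n) (hb : b ≤ n) :
    height (gridPermuton hK n) (gridPt n a) (gridPt n b) = K (gridPt n a) (gridPt n b) := by
  have hterm : ∀ i j : Fin n, ENNReal.ofReal (gridMass K n i j) *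
      ((n * if a ≤ i then volume (cell i) else 0) * (n * if (j : ℕ) < b then volume (cell j) else 0))
      = ENNReal.ofReal (if a ≤ i then (if (j : ℕ) < b then gridMass K n i j else 0) else 0) := by
    intro i j
    split_ifs <;> simp [volume_cell]
  have hnonneg : ∀ i j : ℕ,
      0 ≤ if a ≤ i then (if j < b then gridMass K n i j else 0) else 0 := by
    intro i j
    split_ifs
    exacts [hK.gridMass_nonneg n i j, le_rfl, le_rfl]
  change (gridMeasure K n).real _ = _
  rw [measureReal_def, gridMeasure_prod K n measurableSet_Icc measurableSet_Icc]
  simp only [volume_cell_inter_Icc_one _ ha, volume_cell_inter_Icc_zero _ hb, hterm]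
  have hsum : ∀ i : Fin n, ∑ j : Fin n, ENNReal.ofReal
        (if a ≤ i then (if (j : ℕ) < b then gridMass K n i j else 0) else 0) =
      ENNReal.ofReal (∑ j ∈ Finset.range n,
        if a ≤ i then (if (j : ℕ) < b then gridMass K n i j else 0) else 0) := fun i =>
    sum_fin_ofReal (fun j => hnonneg i j) n
  simp only [hsum]
  rw [sum_fin_ofReal (f := fun i => ∑ j ∈ Finset.range n,
      if a ≤ i then (if (j : ℕ) < b then gridMass K n i j else 0) else 0)
      fun i => Finset.sum_nonneg fun j _ => hnonneg i j,
    ENNReal.toReal_ofReal (Finset.sum_nonneg fun i _ => Finset.sum_nonneg fun j _ => hnonneg i j)]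
  have h := sum_range_ite_le (fun i => K (gridPt n i) (gridPt n b) - K (gridPt n i) 0) ha
  simp only [hK.zero_right, gridPt_self, hK.one_left, sub_zero] at h
  rw [← h]
  refine Finset.sum_congr rfl fun i _ => ?_
  split_ifs with hi
  · simpa only [hK.zero_right, sub_zero] using sum_gridMass_right K hb i
  · simp

/-- Every function with the properties of a height function is the height function of a permuton. -/
theorem IsHeight.exists_height_eq {K : I → I → ℝ} (hK : IsHeight K) :
    ∃ ρ : Permuton, height ρ = K := by
  -- A limit along a nonprincipal ultrafilter replaces the choice of a convergent subsequence.
  obtain ⟨ρ, -, hρ⟩ := isCompact_univ.ultrafilter_le_nhds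
    ((hyperfilter ℕ).map fun n => gridPermuton hK (n + 1)) (by simp)
  have hlim : Tendsto (fun n => gridPermuton hK (n + 1)) (hyperfilter ℕ : Filter ℕ) (𝓝 ρ) := hρ
  have herr : Tendsto (fun n : ℕ => 4 * (1 / ((n + 1 : ℕ) : ℝ))) (hyperfilter ℕ : Filter ℕ) (𝓝 0) := by
    have h0 := (tendsto_one_div_add_atTop_nhds_zero_nat (𝕜 := ℝ)).const_mul 4
    rw [mul_zero] at h0
    refine (h0.congr fun n => by push_cast; rfl).mono_left Nat.hyperfilter_le_atTop
  refine ⟨ρ, funext fun x => funext fun y => ?_⟩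
  have h := tendsto_iff_height.1 hlim x y
  refine le_antisymm ?_ ?_
  · have h' : Tendsto (fun n : ℕ => K x y + 4 * (1 / ((n + 1 : ℕ) : ℝ)))
        (hyperfilter ℕ : Filter ℕ) (𝓝 (K x y)) := by
      simpa using herr.const_add (K x y)
    exact le_of_tendsto_of_tendsto' h h' fun n =>
      (isHeight_height _).le_of_eq_on_grid hK (n + 1)
        (fun i j hi hj => height_gridPermuton hK hi hj) x y
  · have h' := h.add herr
    rw [add_zero] at h'
    exact ge_of_tendsto' h' fun n => hK.le_of_eq_on_grid (isHeight_height _) (n + 1)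
        (fun i j hi hj => (height_gridPermuton hK hi hj).symm) x y

/-! ### Height functions of permutations -/

/-- The number of points of the plot of `u` in positions at least `i` and with values below `j`. -/
def permHeight {n : ℕ} (u : Equiv.Perm (Fin n)) (i j : ℕ) : ℕ :=
  (Finset.univ.filter fun k : Fin n => i ≤ k ∧ (u k : ℕ) < j).card

lemma permHeight_eq_succ {n : ℕ} (u : Equiv.Perm (Fin n)) (i j : ℕ) (hi : i < n) :
    permHeight u i j = permHeight u (i + 1) j + if (u ⟨i, hi⟩ : ℕ) < j then 1 else 0 := by
  classical
  have hs : (Finset.univ.filter fun k : Fin n => i ≤ k ∧ (u k : ℕ) < j) =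
      (Finset.univ.filter fun k : Fin n => i + 1 ≤ k ∧ (u k : ℕ) < j) ∪
        (if (u ⟨i, hi⟩ : ℕ) < j then {⟨i, hi⟩} else ∅) := by
    ext k
    by_cases hk : k = ⟨i, hi⟩
    · subst hk
      split_ifs with h <;> simp [h]
    · have hk' : (k : ℕ) ≠ i := fun h => hk (Fin.ext h)
      have : i ≤ (k : ℕ) ↔ i + 1 ≤ k := by omega
      split_ifs with h <;> simp [hk, this]
  unfold permHeight
  rw [hs, Finset.card_union_of_disjoint]
  · split_ifs <;> simp
  · split_ifs <;> simp

lemma permHeight_of_le {n : ℕ} (u : Equiv.Perm (Fin n)) {i : ℕ} (hi : n ≤ i) (j : ℕ) :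
    permHeight u i j = 0 := by
  unfold permHeight
  rw [Finset.card_eq_zero, Finset.filter_eq_empty_iff]
  intro k _ h
  omega

lemma permHeight_min_left {n : ℕ} (u : Equiv.Perm (Fin n)) (i j : ℕ) :
    permHeight u (min i n) j = permHeight u i j := by
  rcases le_total i n with h | h
  · rw [min_eq_left h]
  · rw [min_eq_right h, permHeight_of_le u h, permHeight_of_le u le_rfl]

lemma permHeight_min_right {n : ℕ} (u : Equiv.Perm (Fin n)) (i j : ℕ) :
    permHeight u i (min j n) = permHeight u i j := by
  unfold permHeight
  congr 1
  ext k
  simp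

/-- A point counted on the left has position at least `c` or position in `[i, c)`. This is the lower
bound in the min-plus formula when the right factor is the identity. -/
lemma permHeight_le_one {n : ℕ} (u : Equiv.Perm (Fin n)) (i j c : ℕ) :
    permHeight u i j ≤ permHeight u c j + permHeight (1 : Equiv.Perm (Fin n)) i c := by
  classical
  refine (Finset.card_le_card ?_).trans (Finset.card_union_le _ _)
  intro k hk
  rw [Finset.mem_filter] at hk
  rw [Finset.mem_union, Finset.mem_filter, Finset.mem_filter]
  rcases le_or_gt c k with h | h
  · exact Or.inl ⟨Finset.mem_univ _, h, hk.2.2⟩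
  · exact Or.inr ⟨Finset.mem_univ _, hk.2.1, h⟩

lemma permHeight_one_self {n : ℕ} (i : ℕ) : permHeight (1 : Equiv.Perm (Fin n)) i i = 0 := by
  unfold permHeight
  rw [Finset.card_eq_zero, Finset.filter_eq_empty_iff]
  intro k _ h
  simp only [Equiv.Perm.one_apply] at h
  omega

/-- The transposition of `m` and `m + 1` preserves the set of positions at least `i` unless `i`
separates the two. -/
lemma permHeight_mul_simple_of_ne {n : ℕ} (u : Equiv.Perm (Fin n)) (m : ℕ) (hm : m + 1 < n)
    (i j : ℕ) (hi : i ≠ m + 1) : permHeight (u * simple m hm) i j = permHeight u i j := by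
  unfold permHeight
  refine Finset.card_equiv (simple m hm) fun k => ?_
  have : i ≤ (k : ℕ) ↔ i ≤ (simple m hm k : ℕ) := by
    unfold simple
    rw [Equiv.swap_apply_def]
    split_ifs with h1 h2
    · subst h1; simp only; omega
    · subst h2; simp only; omega
    · rfl
  rw [Finset.mem_filter, Finset.mem_filter, this]
  simp only [Finset.mem_univ, true_and, Equiv.Perm.mul_apply]

lemma permHeight_bubble_of_ne {n : ℕ} (u : Equiv.Perm (Fin n)) (m : ℕ) (hm : m + 1 < n)
    (i j : ℕ) (hi : i ≠ m + 1) : permHeight (bubble m hm u) i j = permHeight u i j := by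
  unfold bubble
  split_ifs
  · exact permHeight_mul_simple_of_ne u m hm i j hi
  · rfl

/-- After sorting, position `m + 1` holds the smaller of the two entries, so it contributes 1
exactly when at least one of them is below `j`. That contribution is the number of such entries,
capped at 1. -/
lemma permHeight_bubble_succ {n : ℕ} (u : Equiv.Perm (Fin n)) (m : ℕ) (hm : m + 1 < n) (j : ℕ) :
    permHeight (bubble m hm u) (m + 1) j =
      min (permHeight u m j) (permHeight u (m + 2) j + 1) := by
  have h1 := permHeight_eq_succ u m j (Nat.lt_of_succ_lt hm)
  have h2 := permHeight_eq_succ u (m + 1) j hm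
  have h3 := permHeight_eq_succ (bubble m hm u) (m + 1) j hm
  rw [permHeight_bubble_of_ne u m hm (m + 1 + 1) j (by omega)] at h3
  have h4 : bubble m hm u ⟨m + 1, hm⟩ = min (u ⟨m, Nat.lt_of_succ_lt hm⟩) (u ⟨m + 1, hm⟩) := by
    unfold bubble
    split_ifs with h
    · rw [min_eq_left h.le]
      simp [simple]
    · rw [min_eq_right (not_lt.1 h)]
  have h5 : (bubble m hm u ⟨m + 1, hm⟩ : ℕ) =
      min (u ⟨m, Nat.lt_of_succ_lt hm⟩ : ℕ) (u ⟨m + 1, hm⟩ : ℕ) := by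
    rw [h4]
    exact Fin.coe_min _ _
  rw [h3, h1, h2, h5, show m + 1 + 1 = m + 2 from rfl]
  split_ifs <;> omega

lemma demazureMul_bubble {n : ℕ} (u v : Equiv.Perm (Fin n)) (m : ℕ) (hm : m + 1 < n) :
    demazureMul u (bubble m hm v) = bubble m hm (demazureMul u v) := by
  have h := isDemazureMul_demazureMul n
  rw [← h.simple_right, ← h.simple_right, h.assoc]

/-- The height function of a Demazure product of permutations is the min-plus product of the
height functions. -/
theorem isLeast_permHeight_demazureMul {n : ℕ} (u v : Equiv.Perm (Fin n)) (i j : ℕ) :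
    IsLeast (range fun c : ℕ => permHeight u c j + permHeight v i c)
      (permHeight (demazureMul u v) i j) := by
  induction v using bubble_induction generalizing i with
  | h1 =>
    rw [(isDemazureMul_demazureMul n).one_right]
    refine ⟨⟨i, by simp [permHeight_one_self]⟩, ?_⟩
    rintro _ ⟨c, rfl⟩
    exact permHeight_le_one u i j c
  | h m hm v ih =>
    rw [demazureMul_bubble]
    by_cases hi : i = m + 1
    · subst hi
      simp only [permHeight_bubble_succ]
      -- The new row is the minimum of row `m` and of row `m + 2` raised by 1, for `v` and for the
      -- product alike. Min-plus multiplication commutes with minima and with adding constants, so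
      -- the minimizer of whichever row wins is a witness.
      obtain ⟨⟨c, hc⟩, hlow⟩ := ih m
      obtain ⟨⟨d, hd⟩, hlow'⟩ := ih (m + 2)
      simp only at hc hd
      constructor
      · have h1 := hlow ⟨d, rfl⟩
        have h2 := hlow' ⟨c, rfl⟩
        simp only at h1 h2
        rcases le_total (permHeight (demazureMul u v) m j)
          (permHeight (demazureMul u v) (m + 2) j + 1) with h | h
        · exact ⟨c, by simp only; omega⟩
        · exact ⟨d, by simp only; omega⟩
      · rintro _ ⟨c', rfl⟩
        have h1 := hlow ⟨c', rfl⟩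
        have h2 := hlow' ⟨c', rfl⟩
        simp only at h1 h2 ⊢
        omega
    · simp only [permHeight_bubble_of_ne _ m hm i _ hi]
      exact ih i

lemma height_ofPerm {n : ℕ} [NeZero n] (u : Equiv.Perm (Fin n)) {i j : ℕ} (hi : i ≤ n)
    (hj : j ≤ n) : height (ofPerm u) (gridPt n i) (gridPt n j) = permHeight u i j * (1 / n) := by
  have hterm : ∀ k : Fin n, (n : ℝ≥0∞) *
      ((if i ≤ k then volume (cell k) else 0) * (if (u k : ℕ) < j then volume (cell (u k)) else 0))
      = if i ≤ k ∧ (u k : ℕ) < j then ENNReal.ofReal (1 / n) else 0 := by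
    intro k
    have hk : ENNReal.ofReal (1 / n) = volume (cell (u k)) := by
      rw [← one_mul (volume _), ← natCast_mul_ofReal_one_div (n := n), mul_right_comm,
        volume_cell, one_mul]
    by_cases h1 : i ≤ k <;> by_cases h2 : (u k : ℕ) < j
    · simp only [h1, h2, and_self, if_true]
      rw [← mul_assoc, volume_cell, one_mul, hk]
    all_goals simp [h1, h2]
  change (plotMeasure u).real _ = _
  rw [measureReal_def, plotMeasure_prod u measurableSet_Icc measurableSet_Icc]
  simp only [volume_cell_inter_Icc_one _ hi, volume_cell_inter_Icc_zero _ hj, hterm]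
  rw [← Finset.sum_filter, Finset.sum_const, nsmul_eq_mul, ENNReal.toReal_mul,
    ENNReal.toReal_ofReal (by positivity), ENNReal.toReal_natCast]
  rfl

/-! ### The Demazure product of permutons -/

/-- The min-plus product of two functions on the unit square. -/
noncomputable def minPlus (K L : I → I → ℝ) (x y : I) : ℝ := ⨅ γ, (K γ y + L x γ)

namespace IsHeight

variable {K L M : I → I → ℝ}

lemma isLeast_minPlus (hK : IsHeight K) (hL : IsHeight L) (x y : I) :
    IsLeast (range fun γ => K γ y + L x γ) (minPlus K L x y) := by
  have hc : Continuous fun γ => K γ y + L x γ := (hK.continuous_left y).add (hL.continuous_right x)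
  obtain ⟨γ, -, hγ⟩ := isCompact_univ.exists_isMinOn univ_nonempty hc.continuousOn
  have h : IsLeast (range fun γ => K γ y + L x γ) (K γ y + L x γ) :=
    ⟨⟨γ, rfl⟩, by rintro _ ⟨δ, rfl⟩; exact hγ (mem_univ δ)⟩
  rwa [minPlus, iInf, h.csInf_eq]

lemma minPlus_le (hK : IsHeight K) (hL : IsHeight L) (x y γ : I) :
    minPlus K L x y ≤ K γ y + L x γ :=
  (hK.isLeast_minPlus hL x y).2 ⟨γ, rfl⟩

lemma exists_minPlus_eq (hK : IsHeight K) (hL : IsHeight L) (x y : I) :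
    ∃ γ, K γ y + L x γ = minPlus K L x y :=
  (hK.isLeast_minPlus hL x y).1

lemma minPlus_isHeight (hK : IsHeight K) (hL : IsHeight L) : IsHeight (minPlus K L) where
  zero_right x := by
    obtain ⟨γ, hγ⟩ := hK.exists_minPlus_eq hL x 0
    have h1 := hK.minPlus_le hL x 0 0
    have h2 := hK.nonneg γ 0
    have h3 := hL.nonneg x γ
    rw [hK.zero_right, hL.zero_right] at h1
    linarith
  one_right x := by
    obtain ⟨γ, hγ⟩ := hK.exists_minPlus_eq hL x 1
    have h1 := hK.minPlus_le hL x 1 1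
    have h3 := hL.sub_le x γ
    rw [hK.one_left, hL.one_right] at h1
    rw [hK.one_right] at hγ
    linarith
  zero_left y := by
    obtain ⟨γ, hγ⟩ := hK.exists_minPlus_eq hL 0 y
    have h1 := hK.minPlus_le hL 0 y 0
    have h2 := hK.sub_le γ y
    rw [hK.zero_left, hL.zero_left, Icc.coe_zero] at h1
    rw [hL.zero_left] at hγ
    linarith
  one_left y := by
    obtain ⟨γ, hγ⟩ := hK.exists_minPlus_eq hL 1 y
    have h1 := hK.minPlus_le hL 1 y 1
    have h2 := hK.nonneg γ y
    have h3 := hL.nonneg 1 γ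
    rw [hK.one_left, hL.one_left] at h1
    linarith
  rect x x' y y' hx hy := by
    obtain ⟨γ, hγ⟩ := hK.exists_minPlus_eq hL x y'
    obtain ⟨δ, hδ⟩ := hK.exists_minPlus_eq hL x' y
    -- Uncrossing: the smaller of the two minimizers is used at `(x, y)` and the larger at `(x',
    -- y')`. If `γ ≤ δ` only the terms in `K` are exchanged, otherwise only those in `L`, and the
    -- rectangle inequality of that function pays for the exchange.
    rcases le_total γ δ with h | h
    · have h1 := hK.rect γ δ y y' h hy
      have h2 := hK.minPlus_le hL x y γ
      have h3 := hK.minPlus_le hL x' y' δ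
      linarith
    · have h1 := hL.rect x x' δ γ hx h
      have h2 := hK.minPlus_le hL x y δ
      have h3 := hK.minPlus_le hL x' y' γ
      linarith

lemma minPlus_assoc (hK : IsHeight K) (hL : IsHeight L) (hM : IsHeight M) :
    minPlus (minPlus K L) M = minPlus K (minPlus L M) := by
  have hKL := hK.minPlus_isHeight hL
  have hLM := hL.minPlus_isHeight hM
  funext x y
  refine le_antisymm ?_ ?_
  · obtain ⟨γ, hγ⟩ := hK.exists_minPlus_eq hLM x y
    obtain ⟨δ, hδ⟩ := hL.exists_minPlus_eq hM x γ
    have h1 := hKL.minPlus_le hM x y δ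
    have h2 := hK.minPlus_le hL δ y γ
    linarith
  · obtain ⟨γ, hγ⟩ := hKL.exists_minPlus_eq hM x y
    obtain ⟨δ, hδ⟩ := hK.exists_minPlus_eq hL γ y
    have h1 := hK.minPlus_le hLM x y δ
    have h2 := hL.minPlus_le hM x δ γ
    linarith

end IsHeight

lemma isDemazureProduct_iff {μ ν ρ : Permuton} :
    IsDemazureProduct μ ν ρ ↔ height ρ = minPlus (height μ) (height ν) := by
  constructor
  · intro h
    funext x y
    exact (h x y).unique ((isHeight_height μ).isLeast_minPlus (isHeight_height ν) x y)
  · intro h x y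
    rw [h]
    exact (isHeight_height μ).isLeast_minPlus (isHeight_height ν) x y

lemma existsUnique_isDemazureProduct (μ ν : Permuton) : ∃! ρ, IsDemazureProduct μ ν ρ := by
  obtain ⟨ρ, hρ⟩ :=
    ((isHeight_height μ).minPlus_isHeight (isHeight_height ν)).exists_height_eq
  refine ⟨ρ, isDemazureProduct_iff.2 hρ, fun ρ' h => height_injective ?_⟩
  rw [hρ, isDemazureProduct_iff.1 h]

lemma height_identity (x y : I) : height identity x y = max ((y : ℝ) - x) 0 := by
  change ((volume : Measure I).map fun x => (x, x)).real _ = _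
  rw [measureReal_def, Measure.map_apply (by fun_prop) (measurableSet_Icc.prod measurableSet_Icc)]
  have h : (fun x : I => (x, x)) ⁻¹' (Icc x 1 ×ˢ Icc 0 y) = Icc x y := by
    ext z
    exact ⟨fun h => ⟨h.1.1, h.2.2⟩, fun h => ⟨⟨h.1, z.2.2⟩, ⟨z.2.1, h.2⟩⟩⟩
  rw [h, unitInterval.volume_Icc, ENNReal.toReal_ofReal']

/-- The choice `γ = y` gives one bound, since the identity height vanishes on the diagonal. For the
other, replacing `y` by `γ` lowers the height of `μ` by at most `max (y - γ) 0`. -/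
lemma minPlus_identity_left (μ : Permuton) : minPlus (height identity) (height μ) = height μ := by
  have h1 := isHeight_height identity
  have h2 := isHeight_height μ
  funext x y
  refine le_antisymm ?_ ?_
  · have h := h1.minPlus_le h2 x y y
    rw [height_identity, sub_self, max_self, zero_add] at h
    exact h
  · obtain ⟨γ, hγ⟩ := h1.exists_minPlus_eq h2 x y
    rw [← hγ, height_identity]
    rcases le_total γ y with h | h
    · have h3 := h2.right_le_add x y γ
      have h' : (γ : ℝ) ≤ y := h
      rw [abs_of_nonneg (by linarith)] at h3
      have := le_max_left ((y : ℝ) - γ) 0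
      linarith
    · have h3 := h2.mono_right x h
      have := le_max_right ((y : ℝ) - γ) 0
      linarith

lemma minPlus_identity_right (μ : Permuton) : minPlus (height μ) (height identity) = height μ := by
  have h1 := isHeight_height identity
  have h2 := isHeight_height μ
  funext x y
  refine le_antisymm ?_ ?_
  · have h := h2.minPlus_le h1 x y x
    rw [height_identity, sub_self, max_self, add_zero] at h
    exact h
  · obtain ⟨γ, hγ⟩ := h2.exists_minPlus_eq h1 x y
    rw [← hγ, height_identity]
    rcases le_total x γ with h | h
    · have h3 := h2.left_le_add x γ y
      have h' : (x : ℝ) ≤ γ := h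
      rw [abs_sub_comm, abs_of_nonneg (by linarith)] at h3
      have := le_max_left ((γ : ℝ) - x) 0
      linarith
    · have h3 := h2.anti_left h y
      have := le_max_right ((γ : ℝ) - x) 0
      linarith

/-- The Demazure product of permutons. -/
noncomputable def permutonMul (μ ν : Permuton) : Permuton :=
  (existsUnique_isDemazureProduct μ ν).choose

lemma isDemazureProduct_permutonMul (μ ν : Permuton) : IsDemazureProduct μ ν (permutonMul μ ν) :=
  (existsUnique_isDemazureProduct μ ν).choose_spec.1

lemma height_permutonMul (μ ν : Permuton) :
    height (permutonMul μ ν) = minPlus (height μ) (height ν) :=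
  isDemazureProduct_iff.1 (isDemazureProduct_permutonMul μ ν)

/-- The monoid of permutons. -/
noncomputable abbrev permutonMonoid : Monoid Permuton where
  mul := permutonMul
  one := identity
  mul_assoc μ ν ρ := height_injective <| by
    change height (permutonMul (permutonMul μ ν) ρ) = height (permutonMul μ (permutonMul ν ρ))
    simp only [height_permutonMul]
    exact (isHeight_height μ).minPlus_assoc (isHeight_height ν) (isHeight_height ρ)
  one_mul μ := height_injective <|
    (height_permutonMul identity μ).trans (minPlus_identity_left μ)
  mul_one μ := height_injective <|
    (height_permutonMul μ identity).trans (minPlus_identity_right μ)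

/-! ### Convergence of Demazure products of permutations -/

/-- Each of the three heights has two coordinates rounded to the grid, hence `6 / n`. -/
lemma height_ofPerm_demazureMul_le {n : ℕ} [NeZero n] (u v : Equiv.Perm (Fin n)) (x y γ : I) :
    height (ofPerm (demazureMul u v)) x y ≤
      height (ofPerm u) γ y + height (ofPerm v) x γ + 6 * (1 / n) := by
  obtain ⟨i, hi, hxi⟩ := exists_abs_sub_gridPt_le n x
  obtain ⟨j, hj, hyj⟩ := exists_abs_sub_gridPt_le n y
  obtain ⟨c, hc, hγc⟩ := exists_abs_sub_gridPt_le n γ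
  have h1 := (isHeight_height (ofPerm (demazureMul u v))).le_add x (gridPt n i) y (gridPt n j)
  have h2 := (isHeight_height (ofPerm u)).le_add (gridPt n c) γ (gridPt n j) y
  have h3 := (isHeight_height (ofPerm v)).le_add (gridPt n i) x (gridPt n c) γ
  rw [abs_sub_comm _ (γ : ℝ), abs_sub_comm _ (y : ℝ)] at h2
  rw [abs_sub_comm _ (x : ℝ), abs_sub_comm _ (γ : ℝ)] at h3
  rw [height_ofPerm _ hi hj] at h1
  rw [height_ofPerm _ hc hj] at h2
  rw [height_ofPerm _ hi hc] at h3
  have h4 : (permHeight (demazureMul u v) i j : ℝ) ≤ permHeight u c j + permHeight v i c := by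
    exact_mod_cast (isLeast_permHeight_demazureMul u v i j).2 ⟨c, rfl⟩
  have h5 := mul_le_mul_of_nonneg_right h4 (by positivity : (0 : ℝ) ≤ 1 / n)
  linarith

lemma exists_le_height_ofPerm_demazureMul {n : ℕ} [NeZero n] (u v : Equiv.Perm (Fin n))
    (x y : I) : ∃ γ, height (ofPerm u) γ y + height (ofPerm v) x γ ≤
      height (ofPerm (demazureMul u v)) x y + 4 * (1 / n) := by
  obtain ⟨i, hi, hxi⟩ := exists_abs_sub_gridPt_le n x
  obtain ⟨j, hj, hyj⟩ := exists_abs_sub_gridPt_le n y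
  obtain ⟨c, hc⟩ := (isLeast_permHeight_demazureMul u v i j).1
  -- The witness `c` is an arbitrary natural number; truncating it at `n` changes no count and puts
  -- it on the grid.
  have hcn : min c n ≤ n := min_le_right _ _
  refine ⟨gridPt n (min c n), ?_⟩
  have h1 := (isHeight_height (ofPerm (demazureMul u v))).le_add (gridPt n i) x (gridPt n j) y
  have h2 := (isHeight_height (ofPerm u)).right_le_add (gridPt n (min c n)) y (gridPt n j)
  have h3 := (isHeight_height (ofPerm v)).left_le_add x (gridPt n i) (gridPt n (min c n))
  rw [abs_sub_comm _ (x : ℝ), abs_sub_comm _ (y : ℝ)] at h1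
  rw [height_ofPerm _ hi hj] at h1
  rw [height_ofPerm _ hcn hj, permHeight_min_left] at h2
  rw [height_ofPerm _ hi hcn, permHeight_min_right] at h3
  have h4 : (permHeight u c j : ℝ) + permHeight v i c = permHeight (demazureMul u v) i j := by
    exact_mod_cast hc
  rw [← h4] at h1
  linarith

/-- The Lipschitz bounds are uniform over all permutons, so pointwise convergence of heights allows
the point to move as well. This is needed for minimizers that depend on `n`. -/
lemma tendsto_height_of_tendsto {ι : Type*} {l : Filter ι} {μ : ι → Permuton} {ρ : Permuton}
    {x y : ι → I} {a b : I} (hμ : Tendsto μ l (𝓝 ρ)) (hx : Tendsto x l (𝓝 a))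
    (hy : Tendsto y l (𝓝 b)) :
    Tendsto (fun i => height (μ i) (x i) (y i)) l (𝓝 (height ρ a b)) := by
  have h := tendsto_iff_height.1 hμ a b
  have herr : Tendsto (fun i => |(x i : ℝ) - a| + |(y i : ℝ) - b|) l (𝓝 0) := by
    have hx' : Tendsto (fun i => (x i : ℝ)) l (𝓝 a) := (continuous_subtype_val.tendsto a).comp hx
    have hy' : Tendsto (fun i => (y i : ℝ)) l (𝓝 b) := (continuous_subtype_val.tendsto b).comp hy
    simpa using (hx'.sub_const (a : ℝ)).abs.add (hy'.sub_const (b : ℝ)).abs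
  have hlow := h.sub herr
  have hupp := h.add herr
  rw [sub_zero] at hlow
  rw [add_zero] at hupp
  refine tendsto_of_tendsto_of_tendsto_of_le_of_le hlow hupp (fun i => ?_) (fun i => ?_)
  · have := (isHeight_height (μ i)).le_add a (x i) b (y i)
    rw [abs_sub_comm (a : ℝ), abs_sub_comm (b : ℝ)] at this
    linarith
  · have := (isHeight_height (μ i)).le_add (x i) a (y i) b
    linarith

lemma tendsto_ofPerm_demazureMul {μ ν ρ : Permuton} (h : IsDemazureProduct μ ν ρ)
    {u v : (n : ℕ+) → Equiv.Perm (Fin n)} (hu : Tendsto (fun n : ℕ+ => ofPerm (u n)) atTop (𝓝 μ))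
    (hv : Tendsto (fun n : ℕ+ => ofPerm (v n)) atTop (𝓝 ν)) :
    Tendsto (fun n : ℕ+ => ofPerm (demazureMul (u n) (v n))) atTop (𝓝 ρ) := by
  rw [tendsto_iff_ultrafilter]
  intro U hU
  -- By compactness the products converge along each ultrafilter; it remains to identify the limit
  -- `τ` with `ρ` through its height.
  obtain ⟨τ, -, hτ⟩ := isCompact_univ.ultrafilter_le_nhds
    (U.map fun n : ℕ+ => ofPerm (demazureMul (u n) (v n))) (by simp)
  replace hτ : Tendsto (fun n : ℕ+ => ofPerm (demazureMul (u n) (v n))) U (𝓝 τ) := hτ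
  replace hu := hu.mono_left hU
  replace hv := hv.mono_left hU
  have herr : Tendsto (fun n : ℕ+ => 1 / ((n : ℕ) : ℝ)) U (𝓝 0) :=
    (tendsto_one_div_atTop_nhds_zero_nat.comp tendsto_PNat_val_atTop_atTop).mono_left hU
  suffices τ = ρ from this ▸ hτ
  refine height_injective (funext fun x => funext fun y => ?_)
  obtain ⟨⟨γ, hγ⟩, hlow⟩ := h x y
  refine le_antisymm ?_ ?_
  · rw [← hγ]
    have hlim := ((tendsto_iff_height.1 hu γ y).add (tendsto_iff_height.1 hv x γ)).add
      (herr.const_mul 6)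
    rw [mul_zero, add_zero] at hlim
    exact le_of_tendsto_of_tendsto' (tendsto_iff_height.1 hτ x y) hlim fun n =>
      height_ofPerm_demazureMul_le (u n) (v n) x y γ
  -- Near-minimizers for the permutations converge along `U` to some `δ`, which is then tested in
  -- the minimum defining `ρ`.
  · choose c hc using fun n : ℕ+ => exists_le_height_ofPerm_demazureMul (u n) (v n) x y
    obtain ⟨δ, -, hδ⟩ := isCompact_univ.ultrafilter_le_nhds (U.map c) (by simp)
    replace hδ : Tendsto c U (𝓝 δ) := hδ
    refine (hlow ⟨δ, rfl⟩).trans ?_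
    have hlim := (tendsto_iff_height.1 hτ x y).add (herr.const_mul 4)
    rw [mul_zero, add_zero] at hlim
    exact le_of_tendsto_of_tendsto' ((tendsto_height_of_tendsto hu hδ tendsto_const_nhds).add
      (tendsto_height_of_tendsto hv tendsto_const_nhds hδ)) hlim hc

end DemazurePermuton

theorem proposition3p2 :
    (∀ μ ν : DemazurePermuton.Permuton,
      ∃! ρ : DemazurePermuton.Permuton, DemazurePermuton.IsDemazureProduct μ ν ρ) ∧
    (∀ μ ν ρ : DemazurePermuton.Permuton, DemazurePermuton.IsDemazureProduct μ ν ρ →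
      ∀ u v : (n : ℕ+) → Equiv.Perm (Fin n),
        Tendsto (fun n : ℕ+ => DemazurePermuton.ofPerm (u n)) atTop (𝓝 μ) →
        Tendsto (fun n : ℕ+ => DemazurePermuton.ofPerm (v n)) atTop (𝓝 ν) →
        Tendsto (fun n : ℕ+ => DemazurePermuton.ofPerm (DemazurePermuton.demazureMul (u n) (v n)))
          atTop (𝓝 ρ)) ∧
    (∃ M : Monoid DemazurePermuton.Permuton,
      (1 : DemazurePermuton.Permuton) = DemazurePermuton.identity ∧
      ∀ μ ν : DemazurePermuton.Permuton, DemazurePermuton.IsDemazureProduct μ ν (μ * ν)) := by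
  refine ⟨DemazurePermuton.existsUnique_isDemazureProduct, ?_, ?_⟩
  · intro μ ν ρ h u v hu hv
    exact DemazurePermuton.tendsto_ofPerm_demazureMul h hu hv
  · exact ⟨DemazurePermuton.permutonMonoid, rfl, DemazurePermuton.isDemazureProduct_permutonMul⟩
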